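/- Consider an exponential family of probability distributions $P_\theta$, $\theta\in\Theta\subseteq\mathbb{R}^p$ ($\Theta\neq\emptyset$), with natural statistic $Y$ taking values in $\mathbb{R}^p$ and cumulant function $c$: for $\theta,\psi\in\Theta$ the distribution $P_\theta$ has density $e^{\langle Y,\theta-\psi\rangle-c(\theta)+c(\psi)}$ with respect to $P_\psi$, where $c$ is finite on $\Theta$ and $c(\theta)=c(\psi)+\log E_\psi\bigl(e^{\langle Y,\theta-\psi\rangle}\bigr)\in\mathbb{R}\cup\{\infty\}$ for all $\psi\in\Theta$, $\theta\in\mathbb{R}^p$. Suppose that the family is full, that is, $\Theta=\{\theta\in\mathbb{R}^p: c(\theta)<\infty\}$. Let $C$ be its convex support, the smallest closed convex set that contains $Y$ with probability one under some (equivalently, every) distribution in the family. Let $y\in C$ be the observed value of the natural statistic, and let $l(\theta)=\langle y,\theta\rangle-c(\theta)$, $\theta\in\mathbb{R}^p$, be the log likelihood (equal to $-\infty$ where $c(\theta)=\infty$). A vector $\delta\in\mathbb{R}^p$ is a direction of recession (respectively, a direction of constancy) of $l$ if for every $\theta\in\Theta$ the function $s\mapsto l(\theta+s\delta)$ is nondecreasing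 (respectively, constant) on $\mathbb{R}$. Let $$T_C(y)=\operatorname{cl}\{s(w-y): w\in C,\ s\ge 0\},\qquad N_C(y)=\{\delta\in\mathbb{R}^p:\langle w-y,\delta\rangle\le 0\text{ for all }w\in C\}$$ be the tangent cone and the normal cone of $C$ at $y$. Then the following are equivalent. (a) The maximum likelihood estimate exists, that is, $l$ attains its maximum over $\Theta$ at some $\hat\theta\in\Theta$. (b) Every direction of recession of $l$ is a direction of constancy of $l$. (c) $N_C(y)$ is a vector subspace of $\mathbb{R}^p$. (d) $T_C(y)$ is a vector subspace of $\mathbb{R}^p$. -/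

import Mathlib

open MeasureTheory

noncomputable section

/-- An exponential family of probability distributions on `Ω` with natural statistic `Y`, a
nonempty set `Θ ⊆ ℝᵖ` of natural parameter values, distributions `P θ` for `θ ∈ Θ` (the values
`P θ` for `θ ∉ Θ` carry no information), and cumulant function `c : ℝᵖ → ℝ ∪ {∞}`. The cumulant
function is finite on `Θ` and is determined up to an additive constant by
`c θ = c ψ + log E_ψ exp ⟨Y, θ - ψ⟩`, for all `θ ∈ ℝᵖ`; it is `∞` where the expectation is. -/
structure ExponentialFamily (Ω : Type*) [MeasurableSpace Ω] (p : ℕ) where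
  Y : Ω → EuclideanSpace ℝ (Fin p)
  measurable_Y : Measurable Y
  Θ : Set (EuclideanSpace ℝ (Fin p))
  nonempty_Θ : Θ.Nonempty
  P : EuclideanSpace ℝ (Fin p) → Measure Ω
  isProbabilityMeasure_P : ∀ θ ∈ Θ, IsProbabilityMeasure (P θ)
  c : EuclideanSpace ℝ (Fin p) → EReal
  c_finite : ∀ θ ∈ Θ, c θ ≠ ⊥ ∧ c θ ≠ ⊤
  c_eq : ∀ ψ ∈ Θ, ∀ θ, c θ = c ψ +
    ENNReal.log (∫⁻ ω, ENNReal.ofReal (Real.exp (inner ℝ (Y ω) (θ - ψ))) ∂(P ψ))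
  density : ∀ ψ ∈ Θ, ∀ θ ∈ Θ, P θ = (P ψ).withDensity (fun ω =>
    ENNReal.ofReal (Real.exp (inner ℝ (Y ω) (θ - ψ) - (c θ).toReal + (c ψ).toReal)))

/-- The tangent cone of a convex set `C` at a point `y ∈ C`. -/
def tangentCone {p : ℕ} (C : Set (EuclideanSpace ℝ (Fin p))) (y : EuclideanSpace ℝ (Fin p)) :
    Set (EuclideanSpace ℝ (Fin p)) :=
  closure {v | ∃ w ∈ C, ∃ s : ℝ, 0 ≤ s ∧ v = s • (w - y)}

/-- The normal cone of a convex set `C` at a point `y ∈ C`. -/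
def normalCone {p : ℕ} (C : Set (EuclideanSpace ℝ (Fin p))) (y : EuclideanSpace ℝ (Fin p)) :
    Set (EuclideanSpace ℝ (Fin p)) :=
  {δ | ∀ w ∈ C, inner ℝ (w - y) δ ≤ 0}

/-- The set `S` is a vector subspace. -/
def IsVectorSubspace {p : ℕ} (S : Set (EuclideanSpace ℝ (Fin p))) : Prop :=
  ∃ V : Submodule ℝ (EuclideanSpace ℝ (Fin p)), (V : Set (EuclideanSpace ℝ (Fin p))) = S

namespace ExponentialFamily

variable {Ω : Type*} [MeasurableSpace Ω] {p : ℕ} (F : ExponentialFamily Ω p)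

/-- The family is full: every parameter value with finite cumulant function belongs to it. -/
def IsFull : Prop := F.Θ = {θ | F.c θ < ⊤}

/-- The closed convex sets that contain the natural statistic with probability one under some
distribution in the family. -/
def closedConvexCarriers : Set (Set (EuclideanSpace ℝ (Fin p))) :=
  {K | IsClosed K ∧ Convex ℝ K ∧ ∃ θ ∈ F.Θ, ∀ᵐ ω ∂(F.P θ), F.Y ω ∈ K}

/-- The convex support of the family: the smallest closed convex set that contains the natural
statistic with probability one under some distribution in the family. -/
def convexSupport : Set (EuclideanSpace ℝ (Fin p)) := ⋂₀ F.closedConvexCarriers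

/-- The intersection is indeed the smallest such set. -/
theorem isLeast_convexSupport :
    IsLeast F.closedConvexCarriers F.convexSupport := by
  refine ⟨⟨isClosed_sInter fun K hK => hK.1, convex_sInter fun K hK => hK.2.1, ?_⟩,
    fun K hK => Set.sInter_subset_of_mem hK⟩
  obtain ⟨ψ, hψ⟩ := F.nonempty_Θ
  refine ⟨ψ, hψ, ?_⟩
  obtain ⟨T, hTc, hTsub, hTeq⟩ := TopologicalSpace.isOpen_sUnion_countable
    (compl '' F.closedConvexCarriers) (by rintro _ ⟨K, hK, rfl⟩; exact hK.1.isOpen_compl)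
  have hall : ∀ U ∈ T, ∀ᵐ ω ∂(F.P ψ), F.Y ω ∉ U := by
    intro U hU
    obtain ⟨K, ⟨_, _, θ, hθ, h⟩, rfl⟩ := hTsub hU
    rw [F.density θ hθ ψ hψ]
    filter_upwards [(withDensity_absolutelyContinuous _ _).ae_le h] with ω hω using not_not.2 hω
  filter_upwards [(ae_ball_iff hTc).2 hall] with ω hω
  have : F.Y ω ∉ ⋃₀ T := by rintro ⟨U, hU, h⟩; exact hω U hU h
  rw [hTeq, ← Set.compl_sInter] at this
  exact not_not.1 this

/-- The log likelihood `l(θ) = ⟨y, θ⟩ - c(θ)`, defined on all of `ℝᵖ`, with value `-∞` where the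
cumulant function is `∞`. -/
def logLik (y θ : EuclideanSpace ℝ (Fin p)) : EReal := ((inner ℝ y θ : ℝ) : EReal) - F.c θ

/-- `θ` is a maximum likelihood estimate when `y` is the observed value of the statistic. -/
def IsMLE (y θ : EuclideanSpace ℝ (Fin p)) : Prop :=
  θ ∈ F.Θ ∧ ∀ θ' ∈ F.Θ, F.logLik y θ' ≤ F.logLik y θ

/-- `δ` is a direction of recession of the log likelihood: for every `θ ∈ Θ` the function
`s ↦ l(θ + s δ)` is nondecreasing on `ℝ`. -/
def IsDirOfRecession (y δ : EuclideanSpace ℝ (Fin p)) : Prop :=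
  ∀ θ ∈ F.Θ, Monotone (fun s : ℝ => F.logLik y (θ + s • δ))

/-- `δ` is a direction of constancy of the log likelihood: for every `θ ∈ Θ` the function
`s ↦ l(θ + s δ)` is constant on `ℝ`. -/
def IsDirOfConstancy (y δ : EuclideanSpace ℝ (Fin p)) : Prop :=
  ∀ θ ∈ F.Θ, ∀ s t : ℝ, F.logLik y (θ + s • δ) = F.logLik y (θ + t • δ)

end ExponentialFamily

end

/-!
Fix `ψ ∈ Θ` and put `M δ = E_ψ exp ⟨Y - y, δ⟩`. Up to a finite additive constant, `l (ψ + δ)` is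
`-log M δ`, so every comparison of values of `l` is a comparison of values of `M`
(`logLik_le_logLik_iff`).

A direction `δ` is a direction of recession iff `⟨Y - y, δ⟩ ≤ 0` almost surely: if `M (s δ) ≤ 1` for
all `s ≥ 0`, then Markov's inequality leaves no mass where `⟨Y - y, δ⟩ > 0`. As the half-space
`{w | ⟨w - y, δ⟩ ≤ 0}` is closed and convex, this says that `δ` belongs to the normal cone `N` of the
convex support (`isDirOfRecession_iff_mem_normalCone`). Directions of constancy are those `δ` with
`δ, -δ ∈ N`. So every direction of recession is one of constancy iff `N = -N`, which for a convex cone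
means that `N` is a subspace. That `N` is a subspace iff the tangent cone is one follows by polarity
of closed convex cones.

If `l` is maximal at `θ` and `δ ∈ N`, then `E_θ exp ⟨Y - y, δ⟩ = 1` while the integrand is at most
`1`; hence `⟨Y - y, δ⟩ = 0` almost surely and `-δ ∈ N`. Conversely, let `N` be a subspace. Then `M` is
invariant under translations by `N`, so it is enough to minimise it over `Nᗮ`. The set
`{δ ∈ Nᗮ | M δ ≤ 1}` is closed by Fatou's lemma and star-shaped about `0` by convexity of `exp`. If it
were unbounded, it would contain a ray (`exists_ray_of_not_isBounded`), whose direction would be a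
nonzero element of `N ∩ Nᗮ`. It is therefore compact, and the lower semicontinuous function `M`
attains its minimum on it. Since the family is full, the minimiser gives an element of `Θ`.
-/

open MeasureTheory Filter Topology
open scoped ENNReal

/-! ### Closed star-shaped sets -/

/-- In a proper space, an unbounded closed set that is star-shaped about `0` contains a ray. -/
theorem exists_ray_of_not_isBounded {E : Type*} [NormedAddCommGroup E] [NormedSpace ℝ E]
    [ProperSpace E] {K : Set E} (hK : IsClosed K) (hstar : StarConvex ℝ 0 K)
    (hb : ¬ Bornology.IsBounded K) : ∃ δ : E, δ ≠ 0 ∧ ∀ s : ℝ, 0 ≤ s → s • δ ∈ K := by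
  have hlarge : ∀ n : ℕ, ∃ v ∈ K, (n : ℝ) < ‖v‖ := by
    intro n
    by_contra! h
    exact hb (isBounded_iff_forall_norm_le.2 ⟨n, h⟩)
  choose v hvK hv using hlarge
  have hpos : ∀ n, 0 < ‖v n‖ := fun n => (Nat.cast_nonneg n).trans_lt (hv n)
  have hsphere : ∀ n, ‖v n‖⁻¹ • v n ∈ Metric.sphere (0 : E) 1 := fun n => by
    simp [norm_smul, (hpos n).ne']
  obtain ⟨δ, hδ, φ, hφ, hlim⟩ := (isCompact_sphere (0 : E) 1).tendsto_subseq hsphere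
  refine ⟨δ, ?_, fun s hs => ?_⟩
  · rintro rfl
    simp at hδ
  · refine hK.mem_of_tendsto (hlim.const_smul s) ?_
    filter_upwards [eventually_ge_atTop ⌈s⌉₊] with n hn
    have h1 : s ≤ ‖v (φ n)‖ :=
      (Nat.ceil_le.1 (hn.trans (hφ.id_le n))).trans (hv _).le
    have h2 := hstar.smul_mem (hvK (φ n)) (t := s * ‖v (φ n)‖⁻¹)
      (by have := hpos (φ n); positivity) (by
        rw [← div_eq_mul_inv]
        exact (div_le_one (hpos _)).2 h1)
    simpa [Function.comp, mul_smul] using h2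

/-! ### Exponential moments of a random vector -/

section ExpMoment

variable {Ω E : Type*} [MeasurableSpace Ω] [NormedAddCommGroup E] [InnerProductSpace ℝ E]

/-- The moment generating function `δ ↦ E exp ⟨X, δ⟩` of a random vector, with values in `[0, ∞]`. -/
noncomputable def expMoment (μ : Measure Ω) (X : Ω → E) (δ : E) : ℝ≥0∞ :=
  ∫⁻ ω, ENNReal.ofReal (Real.exp (inner ℝ (X ω) δ)) ∂μ

theorem expMoment_zero (μ : Measure Ω) [IsProbabilityMeasure μ] (X : Ω → E) :
    expMoment μ X 0 = 1 := by
  simp [expMoment]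

theorem expMoment_mono_of_ae_le {μ : Measure Ω} {X : Ω → E} {δ δ' : E}
    (h : ∀ᵐ ω ∂μ, inner ℝ (X ω) δ ≤ inner ℝ (X ω) δ') :
    expMoment μ X δ ≤ expMoment μ X δ' :=
  lintegral_mono_ae (h.mono fun _ hω => ENNReal.ofReal_le_ofReal (Real.exp_le_exp.2 hω))

theorem expMoment_smul_le_one {μ : Measure Ω} [IsProbabilityMeasure μ] {X : Ω → E} {δ : E}
    (h : expMoment μ X δ ≤ 1) {s : ℝ} (hs0 : 0 ≤ s) (hs1 : s ≤ 1) :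
    expMoment μ X (s • δ) ≤ 1 := by
  have hpt : ∀ ω, ENNReal.ofReal (Real.exp (inner ℝ (X ω) (s • δ))) ≤
      ENNReal.ofReal (1 - s) +
        ENNReal.ofReal s * ENNReal.ofReal (Real.exp (inner ℝ (X ω) δ)) := by
    intro ω
    rw [← ENNReal.ofReal_mul hs0, ← ENNReal.ofReal_add (by linarith) (by positivity)]
    apply ENNReal.ofReal_le_ofReal
    have := convexOn_exp.2 (Set.mem_univ (0 : ℝ)) (Set.mem_univ (inner ℝ (X ω) δ))
      (sub_nonneg.2 hs1) hs0 (by ring)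
    simpa [inner_smul_right] using this
  calc expMoment μ X (s • δ)
      ≤ ∫⁻ ω, (ENNReal.ofReal (1 - s) +
        ENNReal.ofReal s * ENNReal.ofReal (Real.exp (inner ℝ (X ω) δ))) ∂μ := lintegral_mono hpt
    _ = ENNReal.ofReal (1 - s) + ENNReal.ofReal s * expMoment μ X δ := by
        rw [lintegral_add_left measurable_const, lintegral_const_mul' _ _ ENNReal.ofReal_ne_top]
        simp [expMoment]
    _ ≤ ENNReal.ofReal (1 - s) + ENNReal.ofReal s * 1 := by gcongr
    _ = 1 := by
        rw [mul_one, ← ENNReal.ofReal_add (by linarith) hs0]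
        simp

theorem ae_inner_eq_zero_of_one_le_expMoment {μ : Measure Ω} [IsProbabilityMeasure μ]
    {X : Ω → E} {δ : E} (hδ : ∀ᵐ ω ∂μ, inner ℝ (X ω) δ ≤ 0)
    (h : 1 ≤ expMoment μ X δ) : ∀ᵐ ω ∂μ, inner ℝ (X ω) δ = 0 := by
  have hle : (fun ω => ENNReal.ofReal (Real.exp (inner ℝ (X ω) δ))) ≤ᵐ[μ] fun _ => 1 := by
    filter_upwards [hδ] with ω hω
    simpa using hω
  have hfin : ∫⁻ ω, ENNReal.ofReal (Real.exp (inner ℝ (X ω) δ)) ∂μ ≠ ∞ :=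
    ((lintegral_mono_ae hle).trans_lt (by simp)).ne
  filter_upwards [ae_eq_of_ae_le_of_lintegral_le hle hfin aemeasurable_const
    (by simpa [expMoment] using h)] with ω hω
  simpa using hω

variable [MeasurableSpace E] [BorelSpace E] [SecondCountableTopology E]

theorem measurable_ofReal_exp_inner {X : Ω → E} (hX : Measurable X) (δ : E) :
    Measurable fun ω => ENNReal.ofReal (Real.exp (inner ℝ (X ω) δ)) :=
  (Real.measurable_exp.comp (hX.inner_const)).ennreal_ofReal

/-- Lower semicontinuity of the moment generating function, by Fatou's lemma. -/
theorem lowerSemicontinuous_expMoment (μ : Measure Ω) {X : Ω → E} (hX : Measurable X) :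
    LowerSemicontinuous (expMoment μ X) := by
  rw [lowerSemicontinuous_iff_isClosed_preimage]
  intro r
  apply IsSeqClosed.isClosed
  intro u δ hu hlim
  have hpt : ∀ ω, liminf (fun n => ENNReal.ofReal (Real.exp (inner ℝ (X ω) (u n)))) atTop =
      ENNReal.ofReal (Real.exp (inner ℝ (X ω) δ)) := fun ω => by
    apply Tendsto.liminf_eq
    have hc : Continuous fun v : E => ENNReal.ofReal (Real.exp (inner ℝ (X ω) v)) :=
      ENNReal.continuous_ofReal.comp (by fun_prop)
    exact (hc.tendsto δ).comp hlim
  calc expMoment μ X δ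
      = ∫⁻ ω, liminf (fun n => ENNReal.ofReal (Real.exp (inner ℝ (X ω) (u n)))) atTop ∂μ := by
        simp only [hpt, expMoment]
    _ ≤ liminf (fun n => expMoment μ X (u n)) atTop :=
        lintegral_liminf_le fun n => measurable_ofReal_exp_inner hX (u n)
    _ ≤ r := liminf_le_of_le (by isBoundedDefault) fun b hb => by
        obtain ⟨n, hn⟩ := hb.exists
        exact hn.trans (hu n)

/-- If the moment generating function is bounded by `1` along the ray spanned by `δ`, then the
component of `X` along `δ` is almost surely nonpositive: by Markov's inequality,
`P (⟨X, δ⟩ ≥ ε) ≤ exp (-s ε)` for all `s ≥ 0`. -/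
theorem ae_inner_nonpos_of_expMoment_le_one {μ : Measure Ω} {X : Ω → E} (hX : Measurable X)
    {δ : E} (h : ∀ s : ℝ, 0 ≤ s → expMoment μ X (s • δ) ≤ 1) :
    ∀ᵐ ω ∂μ, inner ℝ (X ω) δ ≤ 0 := by
  have hε : ∀ n : ℕ, ∀ᵐ ω ∂μ, inner ℝ (X ω) δ < 1 / ((n : ℝ) + 1) := by
    intro n
    set ε : ℝ := 1 / ((n : ℝ) + 1) with hεdef
    have hε0 : 0 < ε := by positivity
    have hle : ∀ k : ℕ, μ {ω | ε ≤ inner ℝ (X ω) δ} ≤ ENNReal.ofReal (Real.exp (-(k * ε))) := by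
      intro k
      have hm := mul_meas_ge_le_lintegral (μ := μ)
        (measurable_ofReal_exp_inner hX ((k : ℝ) • δ)) (ENNReal.ofReal (Real.exp (k * ε)))
      have hsub : {ω | ε ≤ inner ℝ (X ω) δ} ⊆ {ω | ENNReal.ofReal (Real.exp (k * ε)) ≤
          ENNReal.ofReal (Real.exp (inner ℝ (X ω) ((k : ℝ) • δ)))} := fun ω hω => by
        refine ENNReal.ofReal_le_ofReal (Real.exp_le_exp.2 ?_)
        rw [inner_smul_right]
        exact mul_le_mul_of_nonneg_left hω (Nat.cast_nonneg k)
      have h1 : ENNReal.ofReal (Real.exp (k * ε)) * μ {ω | ε ≤ inner ℝ (X ω) δ} ≤ 1 :=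
        (mul_le_mul_right (measure_mono hsub) _).trans (hm.trans (h k (Nat.cast_nonneg k)))
      rw [Real.exp_neg, ENNReal.ofReal_inv_of_pos (Real.exp_pos _)]
      rwa [ENNReal.le_inv_iff_mul_le, mul_comm]
    have hlim : Tendsto (fun k : ℕ => ENNReal.ofReal (Real.exp (-(k * ε)))) atTop (𝓝 0) := by
      rw [← ENNReal.ofReal_zero]
      refine ENNReal.tendsto_ofReal (Real.tendsto_exp_neg_atTop_nhds_zero.comp ?_)
      exact tendsto_natCast_atTop_atTop.atTop_mul_const hε0
    have hzero : μ {ω | ε ≤ inner ℝ (X ω) δ} = 0 :=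
      le_antisymm (ge_of_tendsto' hlim hle) bot_le
    rw [ae_iff]
    simpa only [not_lt] using hzero
  filter_upwards [ae_all_iff.2 hε] with ω hω
  exact ge_of_tendsto' tendsto_one_div_add_atTop_nhds_zero_nat fun n => (hω n).le

/-- A moment generating function that is invariant under the subspace `L`, and for which every
direction of recession lies in `L`, attains its minimum. -/
theorem exists_forall_expMoment_le [FiniteDimensional ℝ E] (μ : Measure Ω)
    [IsProbabilityMeasure μ] {X : Ω → E} (hX : Measurable X) (L : Submodule ℝ E)
    (hL : ∀ δ, δ ∈ L ↔ ∀ᵐ ω ∂μ, inner ℝ (X ω) δ ≤ 0) :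
    ∃ δ, ∀ δ', expMoment μ X δ ≤ expMoment μ X δ' := by
  have hproper : ProperSpace E := FiniteDimensional.proper ℝ E
  set K : Set E := {δ | δ ∈ Lᗮ ∧ expMoment μ X δ ≤ 1} with hKdef
  have hlsc := lowerSemicontinuous_expMoment μ hX
  have hKc : IsClosed K :=
    (Submodule.isClosed_orthogonal L).inter (lowerSemicontinuous_iff_isClosed_preimage.1 hlsc 1)
  have hK0 : (0 : E) ∈ K := ⟨zero_mem _, (expMoment_zero μ X).le⟩
  have hstar : StarConvex ℝ 0 K := starConvex_zero_iff.2 fun v hv a ha0 ha1 =>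
    ⟨Lᗮ.smul_mem a hv.1, expMoment_smul_le_one hv.2 ha0 ha1⟩
  have hKb : Bornology.IsBounded K := by
    by_contra hb
    obtain ⟨δ, hδ0, hδ⟩ := exists_ray_of_not_isBounded hKc hstar hb
    have h1 : δ ∈ L := (hL δ).2 (ae_inner_nonpos_of_expMoment_le_one hX fun s hs => (hδ s hs).2)
    have h2 : δ ∈ Lᗮ := by simpa using (hδ 1 zero_le_one).1
    exact hδ0 (inner_self_eq_zero.1 (Submodule.inner_right_of_mem_orthogonal h1 h2))
  obtain ⟨δ, hδK, hδ⟩ := LowerSemicontinuousOn.exists_isMinOn ⟨0, hK0⟩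
    (Metric.isCompact_of_isClosed_isBounded hKc hKb) (hlsc.lowerSemicontinuousOn K)
  refine ⟨δ, fun δ' => ?_⟩
  obtain ⟨a, ha, b, hb, rfl⟩ := L.exists_add_mem_mem_orthogonal δ'
  have hab : expMoment μ X b ≤ expMoment μ X (a + b) := by
    apply expMoment_mono_of_ae_le
    filter_upwards [(hL (-a)).1 (L.neg_mem ha)] with ω hω
    rw [inner_neg_right] at hω
    rw [inner_add_right]
    linarith
  refine le_trans ?_ hab
  by_cases hb1 : expMoment μ X b ≤ 1
  · exact hδ ⟨hb, hb1⟩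
  · exact hδK.2.trans (not_le.1 hb1).le

end ExpMoment

/-! ### Tangent and normal cones -/

section Cones

variable {p : ℕ} {C : Set (EuclideanSpace ℝ (Fin p))} {y : EuclideanSpace ℝ (Fin p)}

theorem isVectorSubspace_normalCone_iff :
    IsVectorSubspace (normalCone C y) ↔ ∀ δ ∈ normalCone C y, -δ ∈ normalCone C y := by
  constructor
  · rintro ⟨V, hV⟩ δ hδ
    rw [← hV] at hδ ⊢
    exact V.neg_mem hδ
  · intro h
    refine ⟨{ carrier := normalCone C y, add_mem' := ?_, zero_mem' := ?_, smul_mem' := ?_ }, rfl⟩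
    · intro a b ha hb w hw
      rw [inner_add_right]
      exact add_nonpos (ha w hw) (hb w hw)
    · intro w _
      simp
    · intro r a ha w hw
      have h1 := ha w hw
      have h2 := h a ha w hw
      rw [inner_neg_right] at h2
      rw [inner_smul_right, show inner ℝ (w - y) a = 0 by linarith, mul_zero]

theorem sub_mem_tangentCone {w : EuclideanSpace ℝ (Fin p)} (hw : w ∈ C) :
    w - y ∈ tangentCone C y :=
  subset_closure ⟨w, hw, 1, zero_le_one, (one_smul ℝ _).symm⟩

theorem smul_mem_tangentCone {v : EuclideanSpace ℝ (Fin p)} (hv : v ∈ tangentCone C y) {r : ℝ}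
    (hr : 0 ≤ r) : r • v ∈ tangentCone C y := by
  refine map_mem_closure (continuous_const_smul r) hv ?_
  rintro _ ⟨w, hw, s, hs, rfl⟩
  exact ⟨w, hw, r * s, mul_nonneg hr hs, smul_smul r s _⟩

theorem convex_tangentCone (hC : Convex ℝ C) : Convex ℝ (tangentCone C y) := by
  refine Convex.closure ?_
  rintro _ ⟨w₁, hw₁, s₁, hs₁, rfl⟩ _ ⟨w₂, hw₂, s₂, hs₂, rfl⟩ a b ha hb _
  have h₁ := mul_nonneg ha hs₁
  have h₂ := mul_nonneg hb hs₂
  rcases (add_nonneg h₁ h₂).eq_or_lt with h0 | hpos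
  · refine ⟨w₁, hw₁, 0, le_rfl, ?_⟩
    rw [smul_smul, smul_smul, show a * s₁ = 0 by linarith, show b * s₂ = 0 by linarith]
    simp
  · -- The two vectors are combined with the weights `a s₁` and `b s₂`, normalised to sum to `1`.
    refine ⟨_, convex_iff_div.1 hC hw₁ hw₂ h₁ h₂ hpos, a * s₁ + b * s₂, hpos.le, ?_⟩
    rw [smul_sub (a * s₁ + b * s₂), smul_add (a * s₁ + b * s₂), smul_smul (a * s₁ + b * s₂),
      smul_smul (a * s₁ + b * s₂), mul_div_cancel₀ _ hpos.ne', mul_div_cancel₀ _ hpos.ne']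
    module

theorem inner_nonpos_of_mem_tangentCone {v δ : EuclideanSpace ℝ (Fin p)}
    (hv : v ∈ tangentCone C y) (hδ : δ ∈ normalCone C y) : inner ℝ v δ ≤ 0 := by
  have hcl : IsClosed {v : EuclideanSpace ℝ (Fin p) | inner ℝ v δ ≤ 0} :=
    isClosed_le (by fun_prop) continuous_const
  refine closure_minimal ?_ hcl hv
  rintro _ ⟨w, hw, s, hs, rfl⟩
  rw [Set.mem_ofPred_eq, real_inner_smul_left]
  exact mul_nonpos_of_nonneg_of_nonpos hs (hδ w hw)

/-- The polar of the normal cone lies in the tangent cone, by separation of a point from a closed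
convex cone. -/
theorem mem_tangentCone_of_inner_nonpos (hC : Convex ℝ C) (hne : C.Nonempty)
    {v : EuclideanSpace ℝ (Fin p)} (hv : ∀ δ ∈ normalCone C y, inner ℝ v δ ≤ 0) :
    v ∈ tangentCone C y := by
  by_contra hnot
  obtain ⟨f, u, hf, hu⟩ :=
    geometric_hahn_banach_closed_point (convex_tangentCone hC) isClosed_closure hnot
  obtain ⟨w₀, hw₀⟩ := hne
  have hu0 : 0 < u := by
    have := hf _ (smul_mem_tangentCone (sub_mem_tangentCone (y := y) hw₀) le_rfl)
    simpa using this
  set δ := (InnerProductSpace.toDual ℝ (EuclideanSpace ℝ (Fin p))).symm f with hδdef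
  have hfδ : ∀ x, inner ℝ x δ = f x := fun x => by
    rw [real_inner_comm, hδdef, InnerProductSpace.toDual_symm_apply]
  have hδ : δ ∈ normalCone C y := by
    intro w hw
    rw [hfδ]
    by_contra! hpos
    -- A positive value of `f` would scale up to the bound `u`.
    have := hf _ (smul_mem_tangentCone (sub_mem_tangentCone (y := y) hw)
      (div_nonneg hu0.le hpos.le))
    rw [map_smul, smul_eq_mul, div_mul_cancel₀ _ hpos.ne'] at this
    exact lt_irrefl _ this
  have := hv δ hδ
  rw [hfδ] at this
  linarith

theorem isVectorSubspace_normalCone_iff_tangentCone (hC : Convex ℝ C) (hne : C.Nonempty) :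
    IsVectorSubspace (normalCone C y) ↔ IsVectorSubspace (tangentCone C y) := by
  constructor
  · rintro ⟨V, hV⟩
    refine ⟨Vᗮ, Set.Subset.antisymm (fun v hv => ?_) (fun v hv => ?_)⟩
    · refine mem_tangentCone_of_inner_nonpos hC hne fun δ hδ => ?_
      rw [← hV] at hδ
      exact (Submodule.inner_left_of_mem_orthogonal hδ hv).le
    · refine (Submodule.mem_orthogonal' V v).2 fun δ hδ => ?_
      have h1 := inner_nonpos_of_mem_tangentCone hv (hV ▸ hδ : δ ∈ normalCone C y)
      have h2 := inner_nonpos_of_mem_tangentCone hv (hV ▸ V.neg_mem hδ : -δ ∈ normalCone C y)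
      rw [inner_neg_right] at h2
      linarith
  · rintro ⟨V, hV⟩
    rw [isVectorSubspace_normalCone_iff]
    intro δ hδ w hw
    have hmem : -(w - y) ∈ tangentCone C y := by
      have := sub_mem_tangentCone (y := y) hw
      rw [← hV] at this ⊢
      exact V.neg_mem this
    have := inner_nonpos_of_mem_tangentCone hmem hδ
    rwa [inner_neg_left, ← inner_neg_right] at this

end Cones

/-! ### Log likelihood and directions of recession -/

namespace ExponentialFamily

variable {Ω : Type*} [MeasurableSpace Ω] {p : ℕ} (F : ExponentialFamily Ω p)
  {y ψ : EuclideanSpace ℝ (Fin p)}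

/-- Centring the statistic at `y` turns `l` into a finite constant minus the logarithm of a moment
generating function. -/
theorem logLik_eq (hψ : ψ ∈ F.Θ) (θ : EuclideanSpace ℝ (Fin p)) :
    F.logLik y θ = ((inner ℝ y ψ - (F.c ψ).toReal : ℝ) : EReal) -
      ENNReal.log (expMoment (F.P ψ) (fun ω => F.Y ω - y) (θ - ψ)) := by
  have hint : ∫⁻ ω, ENNReal.ofReal (Real.exp (inner ℝ (F.Y ω) (θ - ψ))) ∂(F.P ψ) =
      ENNReal.ofReal (Real.exp (inner ℝ y (θ - ψ))) *
        expMoment (F.P ψ) (fun ω => F.Y ω - y) (θ - ψ) := by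
    rw [expMoment, ← lintegral_const_mul' _ _ ENNReal.ofReal_ne_top]
    congr with ω
    rw [← ENNReal.ofReal_mul (Real.exp_pos _).le, ← Real.exp_add, inner_sub_left]
    congr 2
    ring
  obtain ⟨hbot, htop⟩ := F.c_finite ψ hψ
  rw [logLik, F.c_eq ψ hψ θ, hint, ENNReal.log_mul_add,
    ENNReal.log_ofReal_of_pos (Real.exp_pos _), Real.log_exp]
  generalize ENNReal.log (expMoment (F.P ψ) (fun ω => F.Y ω - y) (θ - ψ)) = m
  lift F.c ψ to ℝ using ⟨htop, hbot⟩ with r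
  induction m with
  | bot => rw [EReal.add_bot, EReal.add_bot, EReal.coe_sub_bot, EReal.coe_sub_bot]
  | top => simp
  | coe m =>
    norm_cast
    rw [EReal.toReal_coe, inner_sub_right]
    ring

theorem logLik_le_logLik_iff (hψ : ψ ∈ F.Θ) (θ θ' : EuclideanSpace ℝ (Fin p)) :
    F.logLik y θ ≤ F.logLik y θ' ↔
      expMoment (F.P ψ) (fun ω => F.Y ω - y) (θ' - ψ) ≤
        expMoment (F.P ψ) (fun ω => F.Y ω - y) (θ - ψ) := by
  rw [F.logLik_eq hψ, F.logLik_eq hψ, ← ENNReal.log_le_log_iff]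
  generalize inner ℝ y ψ - (F.c ψ).toReal = r
  rw [sub_eq_add_neg (r : EReal), sub_eq_add_neg (r : EReal),
    (EReal.addLECancellable_coe _).add_le_add_iff_left, EReal.neg_le_neg_iff]

theorem ae_mem_convexSupport (hψ : ψ ∈ F.Θ) : ∀ᵐ ω ∂(F.P ψ), F.Y ω ∈ F.convexSupport := by
  obtain ⟨_, _, θ, hθ, h⟩ := F.isLeast_convexSupport.1
  rw [F.density θ hθ ψ hψ]
  exact (withDensity_absolutelyContinuous _ _).ae_le h

theorem mem_normalCone_iff_ae (hψ : ψ ∈ F.Θ) (δ : EuclideanSpace ℝ (Fin p)) :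
    δ ∈ normalCone F.convexSupport y ↔ ∀ᵐ ω ∂(F.P ψ), inner ℝ (F.Y ω - y) δ ≤ 0 := by
  constructor
  · intro h
    filter_upwards [F.ae_mem_convexSupport hψ] with ω hω using h _ hω
  · intro h
    have hsub : F.convexSupport ⊆ {w | inner ℝ (w - y) δ ≤ 0} := by
      refine F.isLeast_convexSupport.2 ⟨isClosed_le (by fun_prop) continuous_const, ?_, ψ, hψ, h⟩
      intro v hv w hw a b ha hb hab
      have hsplit : a • v + b • w - y = a • (v - y) + b • (w - y) := by
        nth_rw 1 [← one_smul ℝ y, ← hab]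
        module
      rw [Set.mem_ofPred_eq, hsplit, inner_add_left, real_inner_smul_left, real_inner_smul_left]
      exact add_nonpos (mul_nonpos_of_nonneg_of_nonpos ha hv)
        (mul_nonpos_of_nonneg_of_nonpos hb hw)
    exact fun w hw => hsub hw

theorem isDirOfRecession_iff_mem_normalCone (δ : EuclideanSpace ℝ (Fin p)) :
    F.IsDirOfRecession y δ ↔ δ ∈ normalCone F.convexSupport y := by
  constructor
  · intro h
    obtain ⟨ψ, hψ⟩ := F.nonempty_Θ
    have := F.isProbabilityMeasure_P ψ hψ
    rw [F.mem_normalCone_iff_ae hψ]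
    refine ae_inner_nonpos_of_expMoment_le_one (F.measurable_Y.sub_const y) fun s hs => ?_
    have hle := (F.logLik_le_logLik_iff hψ _ _).1 (h ψ hψ hs)
    simpa [expMoment_zero] using hle
  · intro h θ hθ s t hst
    refine (F.logLik_le_logLik_iff hθ _ _).2 (expMoment_mono_of_ae_le ?_)
    filter_upwards [(F.mem_normalCone_iff_ae hθ δ).1 h] with ω hω
    simp only [add_sub_cancel_left, inner_smul_right]
    exact mul_le_mul_of_nonpos_right hst hω

theorem isDirOfConstancy_iff (δ : EuclideanSpace ℝ (Fin p)) :
    F.IsDirOfConstancy y δ ↔ F.IsDirOfRecession y δ ∧ F.IsDirOfRecession y (-δ) := by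
  constructor
  · refine fun h => ⟨fun θ hθ s t _ => (h θ hθ s t).le, fun θ hθ s t _ => ?_⟩
    simpa using (h θ hθ (-s) (-t)).le
  · rintro ⟨h₁, h₂⟩ θ hθ
    have hle : ∀ s t : ℝ, s ≤ t →
        F.logLik y (θ + s • δ) = F.logLik y (θ + t • δ) := fun s t hst => by
      refine le_antisymm (h₁ θ hθ hst) ?_
      simpa using h₂ θ hθ (neg_le_neg hst)
    intro s t
    rcases le_total s t with hst | hst
    · exact hle s t hst
    · exact (hle t s hst).symm

theorem mem_Θ_of_logLik_le (hF : F.IsFull) (hψ : ψ ∈ F.Θ) {θ : EuclideanSpace ℝ (Fin p)}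
    (h : F.logLik y ψ ≤ F.logLik y θ) : θ ∈ F.Θ := by
  rw [hF]
  refine (lt_top_iff_ne_top (a := F.c θ)).2 fun htop => ?_
  have hbot : F.logLik y ψ ≤ ⊥ := by simpa [logLik, htop] using h
  obtain ⟨h₁, h₂⟩ := F.c_finite ψ hψ
  rw [logLik] at hbot
  lift F.c ψ to ℝ using ⟨h₂, h₁⟩ with r
  rw [← EReal.coe_sub] at hbot
  exact EReal.coe_ne_bot _ (le_bot_iff.1 hbot)

theorem neg_mem_normalCone_of_isMLE (hF : F.IsFull) {θ : EuclideanSpace ℝ (Fin p)}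
    (hθ : F.IsMLE y θ) {δ : EuclideanSpace ℝ (Fin p)}
    (hδ : δ ∈ normalCone F.convexSupport y) : -δ ∈ normalCone F.convexSupport y := by
  obtain ⟨hθΘ, hmax⟩ := hθ
  have := F.isProbabilityMeasure_P θ hθΘ
  have hup : F.logLik y θ ≤ F.logLik y (θ + δ) := by
    simpa using (F.isDirOfRecession_iff_mem_normalCone δ).2 hδ θ hθΘ zero_le_one
  have hle := (F.logLik_le_logLik_iff hθΘ _ _).1 (hmax _ (F.mem_Θ_of_logLik_le hF hθΘ hup))
  rw [sub_self, expMoment_zero, add_sub_cancel_left] at hle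
  rw [F.mem_normalCone_iff_ae hθΘ] at hδ ⊢
  filter_upwards [ae_inner_eq_zero_of_one_le_expMoment hδ hle] with ω hω
  rw [inner_neg_right, hω, neg_zero]

theorem exists_isMLE_of_isVectorSubspace_normalCone (hF : F.IsFull)
    (h : IsVectorSubspace (normalCone F.convexSupport y)) : ∃ θ, F.IsMLE y θ := by
  obtain ⟨L, hL⟩ := h
  obtain ⟨ψ, hψ⟩ := F.nonempty_Θ
  have := F.isProbabilityMeasure_P ψ hψ
  obtain ⟨δ, hδ⟩ := exists_forall_expMoment_le (F.P ψ) (F.measurable_Y.sub_const y) L fun δ => by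
    rw [← F.mem_normalCone_iff_ae hψ, ← hL, SetLike.mem_coe]
  have hmax : ∀ θ, F.logLik y θ ≤ F.logLik y (ψ + δ) := fun θ =>
    (F.logLik_le_logLik_iff hψ _ _).2 (by simpa using hδ (θ - ψ))
  exact ⟨ψ + δ, F.mem_Θ_of_logLik_le hF hψ (hmax ψ), fun θ _ => hmax θ⟩

end ExponentialFamily

theorem theorem4 {Ω : Type*} [MeasurableSpace Ω] {p : ℕ} (F : ExponentialFamily Ω p)
    (hF : F.IsFull) (y : EuclideanSpace ℝ (Fin p)) (hy : y ∈ F.convexSupport) :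
    List.TFAE [
      ∃ θ, F.IsMLE y θ,
      ∀ δ, F.IsDirOfRecession y δ → F.IsDirOfConstancy y δ,
      IsVectorSubspace (normalCone F.convexSupport y),
      IsVectorSubspace (tangentCone F.convexSupport y)] := by
  tfae_have 2 ↔ 3 := by
    rw [isVectorSubspace_normalCone_iff]
    simp only [F.isDirOfConstancy_iff, F.isDirOfRecession_iff_mem_normalCone]
    exact forall₂_congr fun δ hδ => and_iff_right hδ
  tfae_have 1 → 3 := fun ⟨_, hθ⟩ => isVectorSubspace_normalCone_iff.2 fun _ hδ =>
    F.neg_mem_normalCone_of_isMLE hF hθ hδ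
  tfae_have 3 → 1 := F.exists_isMLE_of_isVectorSubspace_normalCone hF
  tfae_have 3 ↔ 4 := isVectorSubspace_normalCone_iff_tangentCone
    F.isLeast_convexSupport.1.2.1 ⟨y, hy⟩
  tfae_finish
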